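/- **Setting.** Let $N\ge 2$ and $\alpha\in(0,1)$, let $S^{N-1}\subset\mathbb R^N$ be the unit sphere, $\Delta_{S^{N-1}}$ its Laplace–Beltrami operator, and $\Omega=S^{N-1}\times(-1,1)$. For $\lambda\in(0,\frac\pi2)$ put $$\Delta_{g_\lambda}=\frac{1}{\lambda^2\cos^{N-1}(\lambda t)}\,\partial_t\bigl(\cos^{N-1}(\lambda t)\,\partial_t\bigr)+\frac{1}{\cos^2(\lambda t)}\,\Delta_{S^{N-1}}\qquad\text{for }(\sigma,t)\in\Omega .$$ Let $\tilde u:(-\frac\pi2,\frac\pi2)\to\mathbb R$ be an even $C^2$ solution (it is unique up to an additive constant) of $$\frac{1}{\cos^{N-1}\theta}\bigl(\cos^{N-1}\theta\;\tilde u'(\theta)\bigr)'=-1 .$$ The linearized operator $\mathbb L_\lambda: C^{2,\alpha}(S^{N-1})\to C^{1,\alpha}(S^{N-1})$ is given by $$[\mathbb L_\lambda\omega](\sigma)=-\frac{\tilde u'(\lambda)}{\lambda}\,\partial_t\psi_{\omega,\lambda}(\sigma,1)+\tilde u''(\lambda)\,\omega(\sigma),$$ where $\psi_{\omega,\lambda}\in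 C^{2,\alpha}(\overline\Omega)$ is the unique solution of $\Delta_{g_\lambda}\psi=0$ in $\Omega$, $\psi(\sigma,\pm1)=\omega(\sigma)$ for $\sigma\in S^{N-1}$. For $j\in\mathbb N\cup\{0\}$ let $\gamma_j=j(N-2+j)$. A spherical harmonic of degree $j$ is the restriction to $S^{N-1}$ of a real homogeneous harmonic polynomial of degree $j$ on $\mathbb R^N$. **Proposition 3.1.** For every $j\in\mathbb N\cup\{0\}$ there is a unique continuous function $f_j:[0,\frac\pi2)\to\mathbb R$, differentiable on $(0,\frac\pi2)$, with $$f_j'(\lambda)=-f_j(\lambda)^2+(N-1)\tan\lambda\; f_j(\lambda)+\frac{\gamma_j}{\cos^2\lambda}\quad\text{for }\lambda\in(0,\tfrac\pi2),\qquad f_j(0)=0 .$$ For every $\lambda\in(0,\frac\pi2)$ and every spherical harmonic $Y$ of degree $j\in\mathbb N\cup\{0\}$, the solution $\psi_{Y,\lambda}\in C^{2,\alpha}(\overline\Omega)$ exists and is unique, and $$\mathbb L_\lambda Y=\sigma_j(\lambda)\,Y\ \text{ on } S^{N-1},\qquad \sigma_j(\lambda):=\tilde u'(\lambda)\bigl((N-1)\tan\lambda-f_j(\lambda)\bigr)-1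 ;$$ so every $Y\not\equiv0$ is an eigenfunction of $\mathbb L_\lambda$ with eigenvalue $\sigma_j(\lambda)$. Moreover, $f_0(\lambda)=0$ and $f_1(\lambda)=(N-1)\tan\lambda$ for $\lambda\in[0,\frac\pi2)$, and for every $j\ge2$ $$c_j\tan\lambda\le f_j(\lambda)\le N\,\frac{\sqrt{\gamma_j}}{\cos\lambda}\quad\text{for }\lambda\in[0,\tfrac\pi2),\qquad\text{where } c_j:=\frac{N-2+\sqrt{(N-2)^2+4\gamma_j}}{2}>N-1 .$$ -/

import Mathlib

open Set
open scoped NNReal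

noncomputable section

namespace SerrinSphere

/-- The unit sphere `S^{N-1}` of `ℝ^N`. -/
abbrev Sph (N : ℕ) : Type := Metric.sphere (0 : EuclideanSpace ℝ (Fin N)) 1

/-- The extension `x ↦ f (x / |x|)` of `f : S^{N-1} → ℝ`, homogeneous of degree `0`
(value `0` at the origin). -/
def radialExt {N : ℕ} (f : Sph N → ℝ) (x : EuclideanSpace ℝ (Fin N)) : ℝ :=
  if hx : x = 0 then 0
  else f ⟨‖x‖⁻¹ • x, by
    rw [mem_sphere_zero_iff_norm, norm_smul, norm_inv, norm_norm,
      inv_mul_cancel₀ (norm_ne_zero_iff.mpr hx)]⟩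

/-- The Laplace-Beltrami operator of the round sphere `S^{N-1}`: the Euclidean Laplacian of the
extension `x ↦ f (x / |x|)`, restricted to the sphere. -/
def sphLaplacian {N : ℕ} (f : Sph N → ℝ) (σ : Sph N) : ℝ :=
  Laplacian.laplacian (radialExt f) (σ : EuclideanSpace ℝ (Fin N))

/-- `Y` is a (real valued) spherical harmonic of degree `j`: the restriction to `S^{N-1}` of a
homogeneous harmonic polynomial of degree `j` in `N` variables. -/
def IsSphericalHarmonic {N : ℕ} (j : ℕ) (Y : Sph N → ℝ) : Prop :=
  ∃ P : MvPolynomial (Fin N) ℝ, P.IsHomogeneous j ∧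
    ∑ i, MvPolynomial.pderiv i (MvPolynomial.pderiv i P) = 0 ∧
    ∀ σ : Sph N, Y σ = MvPolynomial.eval (fun i => (σ : EuclideanSpace ℝ (Fin N)) i) P

/-- The operator
`Δ_{g_λ} = 1 / (λ² cos^{N-1} (λ t)) ∂_t (cos^{N-1} (λ t) ∂_t) + 1 / cos² (λ t) Δ_{S^{N-1}}`,
the Laplace-Beltrami operator of the metric `g_λ = λ² dt² + cos² (λ t) g_{S^{N-1}}` on the cylinder
`S^{N-1} × (-1, 1)`. -/
def cylLaplacian {N : ℕ} (lam : ℝ) (ψ : Sph N → ℝ → ℝ) (σ : Sph N) (t : ℝ) : ℝ :=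
  (lam ^ 2 * Real.cos (lam * t) ^ (N - 1))⁻¹ *
      deriv (fun s => Real.cos (lam * s) ^ (N - 1) * deriv (ψ σ) s) t +
    (Real.cos (lam * t) ^ 2)⁻¹ * sphLaplacian (fun σ' => ψ σ' t) σ

/-- `ψ ∈ C^{2,α}(S^{N-1} × [-1, 1])`. The function is extended to `(ℝ^N ∖ {0}) × [-1, 1]` by
homogeneity of degree `0` in the first variable; the extension is `C²` up to the boundary, and its
second derivative is `α`-Hölder continuous on the compact set `S^{N-1} × [-1, 1]`. Only the values
of `ψ` on `S^{N-1} × [-1, 1]` matter. -/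
def IsC2Holder {N : ℕ} (α : ℝ≥0) (ψ : Sph N → ℝ → ℝ) : Prop :=
  let Ψ : EuclideanSpace ℝ (Fin N) × ℝ → ℝ := fun p => radialExt (fun σ => ψ σ p.2) p.1
  let D : Set (EuclideanSpace ℝ (Fin N) × ℝ) := {0}ᶜ ×ˢ Icc (-1) 1
  ContDiffOn ℝ 2 Ψ D ∧
    ∃ C : ℝ≥0, HolderOnWith C α (iteratedFDerivWithin ℝ 2 Ψ D)
      (Metric.sphere (0 : EuclideanSpace ℝ (Fin N)) 1 ×ˢ Icc (-1) 1)

/-- `ψ` is a `C^{2,α}` solution of the Dirichlet problem `Δ_{g_λ} ψ = 0` in `S^{N-1} × (-1, 1)`,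
`ψ(σ, ±1) = ω(σ)` for `σ ∈ S^{N-1}`. -/
structure IsDirichletSolution {N : ℕ} (α : ℝ≥0) (lam : ℝ) (ω : Sph N → ℝ)
    (ψ : Sph N → ℝ → ℝ) : Prop where
  regular : IsC2Holder α ψ
  harmonic : ∀ σ, ∀ t ∈ Ioo (-1 : ℝ) 1, cylLaplacian lam ψ σ t = 0
  boundary : ∀ σ, ψ σ 1 = ω σ ∧ ψ σ (-1) = ω σ

/-- `u` is an even (twice continuously differentiable) solution of
`(1 / cos^{N-1} θ) (cos^{N-1} θ u'(θ))' = -1` on `(-π/2, π/2)`. -/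
structure IsProfile (N : ℕ) (u : ℝ → ℝ) : Prop where
  regular : ContDiffOn ℝ 2 u (Ioo (-(Real.pi / 2)) (Real.pi / 2))
  even : ∀ θ ∈ Ioo (-(Real.pi / 2)) (Real.pi / 2), u (-θ) = u θ
  ode : ∀ θ ∈ Ioo (-(Real.pi / 2)) (Real.pi / 2),
    (Real.cos θ ^ (N - 1))⁻¹ * deriv (fun s => Real.cos s ^ (N - 1) * deriv u s) θ = -1

open Classical in
/-- The linearized operator
`[L_λ ω](σ) = -(u'(λ) / λ) ∂_t ψ_{ω,λ}(σ, 1) + u''(λ) ω(σ)`,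
where `ψ_{ω,λ}` is the `C^{2,α}` solution of the Dirichlet problem with boundary values `ω`
(value `0` by convention if there is none). The derivative at `t = 1` is one-sided. -/
def linOp {N : ℕ} (α : ℝ≥0) (u : ℝ → ℝ) (lam : ℝ) (ω : Sph N → ℝ) (σ : Sph N) : ℝ :=
  if h : ∃ ψ, IsDirichletSolution α lam ω ψ then
    -(deriv u lam / lam) * derivWithin (h.choose σ) (Icc (-1) 1) 1 + deriv (deriv u) lam * ω σ
  else 0

/-- `γ_j = j (N - 2 + j)`. -/
def gam (N j : ℕ) : ℝ := (j : ℝ) * ((N : ℝ) - 2 + j)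

/-- `c_j = (N - 2 + √((N - 2)² + 4 γ_j)) / 2`. -/
def cCoef (N j : ℕ) : ℝ := ((N : ℝ) - 2 + Real.sqrt (((N : ℝ) - 2) ^ 2 + 4 * gam N j)) / 2

/-- `f : [0, π/2) → ℝ` (continuous) solves the Riccati initial value problem
`f' = -f² + (N - 1) tan λ f + γ_j / cos² λ` on `(0, π/2)`, `f 0 = 0`. -/
structure IsRiccatiSolution (N j : ℕ) (f : ℝ → ℝ) : Prop where
  cont : ContinuousOn f (Ico 0 (Real.pi / 2))
  ode : ∀ x ∈ Ioo 0 (Real.pi / 2),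
    HasDerivAt f (-(f x) ^ 2 + ((N : ℝ) - 1) * Real.tan x * f x + gam N j / Real.cos x ^ 2) x
  init : f 0 = 0

/-- `σ_j(λ) = u'(λ) ((N - 1) tan λ - f_j(λ)) - 1`, as a function of `u` and `f = f_j`. -/
def sigmaEig (N : ℕ) (u f : ℝ → ℝ) (lam : ℝ) : ℝ :=
  deriv u lam * (((N : ℝ) - 1) * Real.tan lam - f lam) - 1

end SerrinSphere

end

open SerrinSphere

noncomputable section

namespace SerrinSphere

open Filter Topology

/-! ### Power series and the Riccati equation -/

/-! The Riccati equation is that of a logarithmic derivative: `f = h'/h` solves it when `(cos^{N-1}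
h')' = γ_j cos^{N-3} h`, the equation left by separating variables in `Δ_{g_λ}` on spherical
harmonics of degree `j`. Writing `h = cos^j · v(sin)` gives a Gegenbauer-type equation for `v`,
solved by an even power series with nonnegative coefficients and `v 0 = 1`. So `h` is positive and
even on `(-π/2, π/2)`, and `h'/h` is the required `f_j` (`isRiccatiSolution_riccatiSol`).

Subsolutions of the Riccati equation stay below supersolutions (`riccati_comparison`). This gives
uniqueness, hence the closed forms for `j = 0, 1`, and also the two bounds, since `c_j tan` is a
subsolution and `N √γ_j / cos` a supersolution.

Since `Δ_{S^{N-1}} Y = -γ_j Y` (`sphLaplacian_of_isSphericalHarmonic`), the function `h(λt)/h(λ) ·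
Y` solves the Dirichlet problem (`isDirichletSolution_separated`). It is the only solution by a
maximum principle with an exponential barrier (`IsDirichletSolution.le`). Its normal derivative at
`t = 1` is `λ f_j(λ) Y`, and the profile equation expresses `u''` through `u'`; together they give
`σ_j`. -/

/-- The sequence `a` grows at most polynomially. -/
def PolyGrowth (a : ℕ → ℝ) : Prop :=
  ∃ (C : ℝ) (k : ℕ), ∀ n, |a n| ≤ C * ((n : ℝ) + 1) ^ k

/-- The coefficients of the derivative of the power series with coefficients `a`. -/
def derivCoef (a : ℕ → ℝ) (n : ℕ) : ℝ := ((n : ℝ) + 1) * a (n + 1)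

/-- The sum of the power series with coefficients `a`. -/
def seriesSum (a : ℕ → ℝ) (s : ℝ) : ℝ := ∑' n, a n * s ^ n

lemma PolyGrowth.derivCoef {a : ℕ → ℝ} (ha : PolyGrowth a) : PolyGrowth (derivCoef a) := by
  obtain ⟨C, k, h⟩ := ha
  refine ⟨C * 2 ^ k, k + 1, fun n => ?_⟩
  have hn : (0 : ℝ) ≤ n := n.cast_nonneg
  have h1 := h (n + 1)
  have hC : 0 ≤ C := by
    have := (abs_nonneg _).trans (h 0)
    simpa using this
  have h2 : ((n : ℝ) + 1 + 1) ^ k ≤ (2 * ((n : ℝ) + 1)) ^ k := by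
    gcongr; linarith
  push_cast at h1
  rw [SerrinSphere.derivCoef, abs_mul, abs_of_nonneg (by positivity : (0 : ℝ) ≤ (n : ℝ) + 1)]
  calc ((n : ℝ) + 1) * |a (n + 1)| ≤ ((n : ℝ) + 1) * (C * (2 * ((n : ℝ) + 1)) ^ k) := by
        gcongr
        exact h1.trans (by gcongr)
    _ = C * 2 ^ k * ((n : ℝ) + 1) ^ (k + 1) := by rw [mul_pow]; ring

lemma PolyGrowth.summable_abs {a : ℕ → ℝ} (ha : PolyGrowth a) {r : ℝ} (h0 : 0 ≤ r) (h1 : r < 1) :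
    Summable fun n => |a n| * r ^ n := by
  obtain ⟨C, k, h⟩ := ha
  -- Since `r` may be `0`, it is replaced by a positive `q < 1`; the index shift below divides by
  -- `q`.
  obtain ⟨q, hq, hq1⟩ := exists_between h1
  have hq0 : 0 < q := h0.trans_lt hq
  have h2 : Summable fun n : ℕ => ((n : ℝ) ^ k * q ^ n) :=
    summable_pow_mul_geometric_of_norm_lt_one k (by rwa [Real.norm_of_nonneg hq0.le])
  have h3 : Summable fun n : ℕ => C / q * (((n + 1 : ℕ) : ℝ) ^ k * q ^ (n + 1)) :=
    ((summable_nat_add_iff 1).2 h2).mul_left (C / q)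
  refine Summable.of_nonneg_of_le (fun n => mul_nonneg (abs_nonneg _) (pow_nonneg h0 _))
    (fun n => ?_) h3
  calc |a n| * r ^ n ≤ C * ((n : ℝ) + 1) ^ k * q ^ n :=
        mul_le_mul (h n) (pow_le_pow_left₀ h0 hq.le n) (pow_nonneg h0 _)
          ((abs_nonneg _).trans (h n))
    _ = C / q * (((n + 1 : ℕ) : ℝ) ^ k * q ^ (n + 1)) := by
        rw [pow_succ q n, Nat.cast_succ]
        have := hq0.ne'
        generalize ((n : ℝ) + 1) ^ k = X
        generalize q ^ n = Y
        field_simp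

lemma PolyGrowth.hasSum {a : ℕ → ℝ} (ha : PolyGrowth a) {s : ℝ} (hs : |s| < 1) :
    HasSum (fun n => a n * s ^ n) (seriesSum a s) := by
  refine Summable.hasSum (Summable.of_norm ?_)
  simpa [abs_mul, abs_pow] using ha.summable_abs (abs_nonneg s) hs

/-- Together with its second-order analogue, this lets the differential equation for `v` be checked
coefficient by coefficient. The term `n = 0` vanishes, so the index can be shifted. -/
lemma PolyGrowth.hasSum_nat_mul {a : ℕ → ℝ} (ha : PolyGrowth a) {s : ℝ} (hs : |s| < 1) :
    HasSum (fun n : ℕ => (n : ℝ) * a n * s ^ n) (s * seriesSum (SerrinSphere.derivCoef a) s) := by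
  rw [← hasSum_nat_add_iff' 1]
  convert! (ha.derivCoef.hasSum hs).mul_left s using 1
  · ext n
    simp only [SerrinSphere.derivCoef]
    push_cast
    ring
  · simp

lemma PolyGrowth.hasSum_nat_mul_sub_one {a : ℕ → ℝ} (ha : PolyGrowth a) {s : ℝ} (hs : |s| < 1) :
    HasSum (fun n : ℕ => (n : ℝ) * ((n : ℝ) - 1) * a n * s ^ n)
      (s ^ 2 * seriesSum (SerrinSphere.derivCoef (SerrinSphere.derivCoef a)) s) := by
  rw [← hasSum_nat_add_iff' 1]
  convert! (ha.derivCoef.hasSum_nat_mul hs).mul_left s using 1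
  · ext n
    simp only [SerrinSphere.derivCoef]
    push_cast
    ring
  · simp; ring

lemma PolyGrowth.hasDerivAt {a : ℕ → ℝ} (ha : PolyGrowth a) {s : ℝ} (hs : |s| < 1) :
    HasDerivAt (seriesSum a) (seriesSum (SerrinSphere.derivCoef a) s) s := by
  obtain ⟨r, hr, hr1⟩ := exists_between hs
  have hr0 : 0 ≤ r := (abs_nonneg s).trans hr.le
  have hu : Summable fun n : ℕ => (n : ℝ) * |a n| * r ^ (n - 1) := by
    rw [← summable_nat_add_iff 1]
    refine (ha.derivCoef.summable_abs hr0 hr1).congr fun n => ?_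
    have : (0 : ℝ) ≤ (n : ℝ) + 1 := by positivity
    simp [SerrinSphere.derivCoef, abs_mul, abs_of_nonneg this]
  have key := hasDerivAt_tsum_of_isPreconnected (𝕜 := ℝ) (g := fun n x => a n * x ^ n)
    (g' := fun n x => a n * ((n : ℝ) * x ^ (n - 1))) (t := Ioo (-r) r) (y₀ := 0) (y := s) hu isOpen_Ioo
    isPreconnected_Ioo (fun n y _ => (hasDerivAt_pow n y).const_mul _)
    (fun n y hy => by
      have : |y| ≤ r := (abs_lt.2 hy).le
      rw [Real.norm_eq_abs, abs_mul, abs_mul, abs_pow, Nat.abs_cast]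
      calc |a n| * ((n : ℝ) * |y| ^ (n - 1)) = (n : ℝ) * |a n| * |y| ^ (n - 1) := by ring
        _ ≤ _ := by gcongr)
    (by simp only [mem_Ioo]; constructor <;> linarith [abs_nonneg s])
    (ha.hasSum (by simp)).summable (abs_lt.1 hr)
  have h2 : HasSum (fun n => a n * ((n : ℝ) * s ^ (n - 1))) (seriesSum (SerrinSphere.derivCoef a) s) := by
    rw [← hasSum_nat_add_iff' 1]
    convert! ha.derivCoef.hasSum hs using 1
    · ext n
      simp only [SerrinSphere.derivCoef, Nat.add_sub_cancel]
      push_cast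
      ring
    · simp
  rw [h2.tsum_eq] at key
  exact key

lemma PolyGrowth.contDiffOn {a : ℕ → ℝ} (ha : PolyGrowth a) (n : ℕ) :
    ContDiffOn ℝ n (seriesSum a) (Ioo (-1) 1) := by
  induction n generalizing a with
  | zero =>
    exact contDiffOn_zero.2 fun x hx =>
      (ha.hasDerivAt (abs_lt.2 hx)).continuousAt.continuousWithinAt
  | succ n ih =>
    push_cast
    rw [contDiffOn_succ_iff_deriv_of_isOpen isOpen_Ioo]
    refine ⟨fun x hx => (ha.hasDerivAt (abs_lt.2 hx)).differentiableAt.differentiableWithinAt,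
      by simp, (ih ha.derivCoef).congr fun x hx => (ha.hasDerivAt (abs_lt.2 hx)).deriv⟩

/-! ### The power series solution and its logarithmic derivative. -/

/-- Taylor coefficients of the even solution `v`, `v 0 = 1`, of
`(1 - s²) v'' - (N + 2 j) s v' - j (j + N - 1) v = 0`. -/
def gegenCoef (N j : ℕ) : ℕ → ℝ
  | 0 => 1
  | 1 => 0
  | n + 2 => ((n : ℝ) + j) * ((n : ℝ) + j + N - 1) / (((n : ℝ) + 1) * ((n : ℝ) + 2)) * gegenCoef N j n

lemma gegenCoef_ratio_nonneg {N : ℕ} (hN : 1 ≤ N) (j n : ℕ) :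
    0 ≤ ((n : ℝ) + j) * ((n : ℝ) + j + N - 1) / (((n : ℝ) + 1) * ((n : ℝ) + 2)) := by
  have : (1 : ℝ) ≤ N := by exact_mod_cast hN
  have h2 : (0 : ℝ) ≤ (n : ℝ) + j + N - 1 := by
    have : (0 : ℝ) ≤ (n : ℝ) + j := by positivity
    linarith
  positivity

lemma gegenCoef_nonneg {N : ℕ} (hN : 1 ≤ N) (j : ℕ) : ∀ n, 0 ≤ gegenCoef N j n
  | 0 => by simp [gegenCoef]
  | 1 => by simp [gegenCoef]
  | n + 2 => by
    rw [gegenCoef]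
    exact mul_nonneg (gegenCoef_ratio_nonneg hN j n) (gegenCoef_nonneg hN j n)

/-- The odd coefficients vanish, so the sign of `s` is irrelevant: each step of two contributes a
factor `s²`. This yields `v ≥ 1`, hence no zeros of `h`. -/
lemma gegenCoef_mul_pow_nonneg {N : ℕ} (hN : 1 ≤ N) (j : ℕ) (s : ℝ) :
    ∀ n, 0 ≤ gegenCoef N j n * s ^ n
  | 0 => by simp [gegenCoef]
  | 1 => by simp [gegenCoef]
  | n + 2 => by
    have h1 := gegenCoef_mul_pow_nonneg hN j s n
    have h2 := gegenCoef_ratio_nonneg hN j n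
    rw [gegenCoef, pow_add]
    have := mul_nonneg (mul_nonneg h2 h1) (sq_nonneg s)
    linarith

/-- With `K = (j + N)²`, the ratio of consecutive even coefficients is at most `1 + 2K/(n+1)`, which
Bernoulli's inequality bounds by `((n+3)/(n+1))^K`; the product telescopes. -/
lemma gegenCoef_le {N : ℕ} (hN : 1 ≤ N) (j : ℕ) :
    ∀ n : ℕ, gegenCoef N j n ≤ ((n : ℝ) + 1) ^ ((j + N) ^ 2)
  | 0 => by simp [gegenCoef]
  | 1 => by simp only [gegenCoef]; positivity
  | n + 2 => by
    have ih := gegenCoef_le hN j n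
    have hr := gegenCoef_ratio_nonneg hN j n
    have hN' : (1 : ℝ) ≤ N := by exact_mod_cast hN
    have hn : (0 : ℝ) ≤ n := n.cast_nonneg
    have hj : (0 : ℝ) ≤ j := j.cast_nonneg
    set K := (j + N) ^ 2 with hK
    have hKr : (K : ℝ) = ((j : ℝ) + N) ^ 2 := by rw [hK]; push_cast; ring
    have hb := one_add_mul_le_pow (a := 2 / ((n : ℝ) + 1)) (by
      have : (0 : ℝ) ≤ 2 / ((n : ℝ) + 1) := by positivity
      linarith) K
    have hq : ((n : ℝ) + 3) ^ K = ((n : ℝ) + 1) ^ K * (1 + 2 / ((n : ℝ) + 1)) ^ K := by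
      rw [← mul_pow]
      congr 1
      field_simp
      ring
    have hle : ((n : ℝ) + j) * ((n : ℝ) + j + N - 1) / (((n : ℝ) + 1) * ((n : ℝ) + 2)) ≤
        1 + (K : ℝ) * (2 / ((n : ℝ) + 1)) := by
      rw [show 1 + (K : ℝ) * (2 / ((n : ℝ) + 1)) =
        (((n : ℝ) + 1 + 2 * K) * ((n : ℝ) + 2)) / (((n : ℝ) + 1) * ((n : ℝ) + 2)) by field_simp]
      refine div_le_div_of_nonneg_right ?_ (by positivity)
      rw [hKr]
      nlinarith [mul_nonneg hn hj, mul_nonneg hj hj, mul_nonneg hn (sq_nonneg ((j : ℝ) + N - 1)),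
        mul_nonneg hj (sub_nonneg.2 hN'), mul_nonneg hn (sub_nonneg.2 hN')]
    rw [gegenCoef]
    push_cast
    calc _ ≤ (1 + (K : ℝ) * (2 / ((n : ℝ) + 1))) * ((n : ℝ) + 1) ^ K :=
          mul_le_mul hle ih (gegenCoef_nonneg hN j n) (hr.trans hle)
      _ ≤ (1 + 2 / ((n : ℝ) + 1)) ^ K * ((n : ℝ) + 1) ^ K := by gcongr
      _ = ((n : ℝ) + 2 + 1) ^ K := by rw [mul_comm, ← hq]; ring

lemma polyGrowth_gegenCoef {N : ℕ} (hN : 1 ≤ N) (j : ℕ) : PolyGrowth (gegenCoef N j) :=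
  ⟨1, (j + N) ^ 2, fun n => by
    rw [abs_of_nonneg (gegenCoef_nonneg hN j n), one_mul]
    exact gegenCoef_le hN j n⟩

lemma seriesSum_gegenCoef_pos {N : ℕ} (hN : 1 ≤ N) (j : ℕ) {s : ℝ} (hs : |s| < 1) :
    0 < seriesSum (gegenCoef N j) s := by
  have h := le_hasSum ((polyGrowth_gegenCoef hN j).hasSum hs) 0
    fun n _ => gegenCoef_mul_pow_nonneg hN j s n
  simp only [gegenCoef, pow_zero, mul_one] at h
  linarith

lemma seriesSum_zero (a : ℕ → ℝ) : seriesSum a 0 = a 0 := by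
  rw [seriesSum, tsum_eq_single 0 fun n hn => by simp [hn]]
  simp

/-- The recursion is built for this: `(n+j)(n+j+N-1) = n(n-1) + (N+2j) n + j(j+N-1)`. -/
lemma seriesSum_gegenCoef_ode {N : ℕ} (hN : 1 ≤ N) (j : ℕ) {s : ℝ} (hs : |s| < 1) :
    (1 - s ^ 2) * seriesSum (derivCoef (derivCoef (gegenCoef N j))) s =
      ((N : ℝ) + 2 * j) * s * seriesSum (derivCoef (gegenCoef N j)) s +
        (j : ℝ) * ((j : ℝ) + N - 1) * seriesSum (gegenCoef N j) s := by
  have ha := polyGrowth_gegenCoef hN j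
  have h0 := (ha.hasSum hs).mul_left ((j : ℝ) * ((j : ℝ) + N - 1))
  have h1 := (ha.hasSum_nat_mul hs).mul_left ((N : ℝ) + 2 * j)
  have h2 := ha.hasSum_nat_mul_sub_one hs
  have h3 := ha.derivCoef.derivCoef.hasSum hs
  have h4 : (fun n => SerrinSphere.derivCoef (SerrinSphere.derivCoef (gegenCoef N j)) n * s ^ n) =
      fun n : ℕ => (n : ℝ) * ((n : ℝ) - 1) * gegenCoef N j n * s ^ n +
        (((N : ℝ) + 2 * j) * ((n : ℝ) * gegenCoef N j n * s ^ n) +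
        (j : ℝ) * ((j : ℝ) + N - 1) * (gegenCoef N j n * s ^ n)) := by
    ext n
    simp only [SerrinSphere.derivCoef, gegenCoef]
    push_cast
    field_simp
    ring
  rw [h4] at h3
  have := h3.unique (h2.add (h1.add h0))
  linarith

/-- The even solution `h`, `h 0 = 1`, of `(cos^{N-1} h')' = γ_j cos^{N-3} h`. -/
def radialSol (N j : ℕ) (θ : ℝ) : ℝ := Real.cos θ ^ j * seriesSum (gegenCoef N j) (Real.sin θ)

/-- The logarithmic derivative of `radialSol`. -/
def riccatiSol (N j : ℕ) (θ : ℝ) : ℝ :=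
  -(j : ℝ) * Real.tan θ + Real.cos θ * (seriesSum (derivCoef (gegenCoef N j)) (Real.sin θ) /
    seriesSum (gegenCoef N j) (Real.sin θ))

lemma abs_sin_lt_one {θ : ℝ} (hθ : θ ∈ Ioo (-(Real.pi / 2)) (Real.pi / 2)) : |Real.sin θ| < 1 := by
  have hc := Real.cos_pos_of_mem_Ioo hθ
  rw [← sq_lt_one_iff_abs_lt_one]
  nlinarith [Real.sin_sq_add_cos_sq θ]

/-- Positivity of `v` makes the quotient differentiable, and the equation for `v` eliminates `v''`.
The symmetric interval is needed because the cylinder uses `θ = λt` with `t` of either sign. -/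
lemma hasDerivAt_riccatiSol {N : ℕ} (hN : 1 ≤ N) (j : ℕ) {θ : ℝ}
    (hθ : θ ∈ Ioo (-(Real.pi / 2)) (Real.pi / 2)) :
    HasDerivAt (riccatiSol N j) (-(riccatiSol N j θ) ^ 2 +
      ((N : ℝ) - 1) * Real.tan θ * riccatiSol N j θ + gam N j / Real.cos θ ^ 2) θ := by
  have hs := abs_sin_lt_one hθ
  have hc := Real.cos_pos_of_mem_Ioo hθ
  have ha := polyGrowth_gegenCoef hN j
  have hv := seriesSum_gegenCoef_pos hN j hs
  have h1 := (ha.hasDerivAt hs).comp θ (Real.hasDerivAt_sin θ)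
  have h2 := (ha.derivCoef.hasDerivAt hs).comp θ (Real.hasDerivAt_sin θ)
  have h3 := ((Real.hasDerivAt_tan hc.ne').const_mul (-(j : ℝ))).add
    ((Real.hasDerivAt_cos θ).mul (h2.div h1 hv.ne'))
  have hode := seriesSum_gegenCoef_ode hN j hs
  rw [← Real.cos_sq'] at hode
  refine h3.congr_deriv ?_
  simp only [riccatiSol, gam, Function.comp, Pi.div_apply]
  set v := seriesSum (gegenCoef N j) (Real.sin θ)
  set v' := seriesSum (derivCoef (gegenCoef N j)) (Real.sin θ)
  set v'' := seriesSum (derivCoef (derivCoef (gegenCoef N j))) (Real.sin θ)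
  rw [Real.tan_eq_sin_div_cos]
  have hsc := Real.sin_sq_add_cos_sq θ
  set S := Real.sin θ
  set c := Real.cos θ
  have hv'' : v'' = (((N : ℝ) + 2 * j) * S * v' + (j : ℝ) * ((j : ℝ) + N - 1) * v) / c ^ 2 := by
    rw [← hode]; field_simp
  rw [hv'']
  have hS : S ^ 2 = 1 - c ^ 2 := by linarith
  field_simp
  ring_nf
  rw [hS]
  ring

lemma radialSol_pos {N : ℕ} (hN : 1 ≤ N) (j : ℕ) {θ : ℝ}
    (hθ : θ ∈ Ioo (-(Real.pi / 2)) (Real.pi / 2)) : 0 < radialSol N j θ :=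
  mul_pos (pow_pos (Real.cos_pos_of_mem_Ioo hθ) _) (seriesSum_gegenCoef_pos hN j (abs_sin_lt_one hθ))

lemma hasDerivAt_radialSol {N : ℕ} (hN : 1 ≤ N) (j : ℕ) {θ : ℝ}
    (hθ : θ ∈ Ioo (-(Real.pi / 2)) (Real.pi / 2)) :
    HasDerivAt (radialSol N j) (riccatiSol N j θ * radialSol N j θ) θ := by
  have hs := abs_sin_lt_one hθ
  have hc := Real.cos_pos_of_mem_Ioo hθ
  have hv := seriesSum_gegenCoef_pos hN j hs
  have h1 := ((polyGrowth_gegenCoef hN j).hasDerivAt hs).comp θ (Real.hasDerivAt_sin θ)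
  refine (((Real.hasDerivAt_cos θ).pow j).mul h1).congr_deriv ?_
  simp only [riccatiSol, radialSol, Function.comp, Real.tan_eq_sin_div_cos]
  rcases j with _ | j
  · simp; field_simp
  · simp only [Nat.add_sub_cancel, Pi.pow_apply]
    push_cast
    field_simp
    ring

lemma radialSol_neg (N j : ℕ) (θ : ℝ) : radialSol N j (-θ) = radialSol N j θ := by
  have h : ∀ n, gegenCoef N j n * (-Real.sin θ) ^ n = gegenCoef N j n * Real.sin θ ^ n := by
    intro n
    induction n using Nat.twoStepInduction with
    | zero => simp
    | one => simp [gegenCoef]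
    | more n ih _ =>
      simp only [gegenCoef, pow_add]
      linear_combination ((n : ℝ) + j) * ((n : ℝ) + j + N - 1) /
        (((n : ℝ) + 1) * ((n : ℝ) + 2)) * Real.sin θ ^ 2 * ih
  simp only [radialSol, Real.cos_neg, Real.sin_neg, seriesSum, h]

lemma contDiffOn_radialSol {N : ℕ} (hN : 1 ≤ N) (j n : ℕ) :
    ContDiffOn ℝ n (radialSol N j) (Ioo (-(Real.pi / 2)) (Real.pi / 2)) := by
  refine (Real.contDiff_cos.pow j).contDiffOn.mul ?_
  exact ((polyGrowth_gegenCoef hN j).contDiffOn n).comp Real.contDiff_sin.contDiffOn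
    fun θ hθ => abs_lt.1 (abs_sin_lt_one hθ)

lemma isRiccatiSolution_riccatiSol {N : ℕ} (hN : 1 ≤ N) (j : ℕ) :
    IsRiccatiSolution N j (riccatiSol N j) where
  cont := fun x hx => (hasDerivAt_riccatiSol hN j
    ⟨by linarith [hx.1, Real.pi_pos], hx.2⟩).continuousAt.continuousWithinAt
  ode := fun x hx => hasDerivAt_riccatiSol hN j ⟨by linarith [hx.1, Real.pi_pos], hx.2⟩
  init := by simp [riccatiSol, seriesSum_zero, derivCoef, gegenCoef]

/-! ### Comparison for the Riccati equation, and the bounds on its solutions. -/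

/-- Integrating factor: `d · exp(-∫ A)` is nondecreasing and starts at `d 0 ≥ 0`. -/
lemma nonneg_of_linear_differential_inequality {A d d' : ℝ → ℝ} {b : ℝ}
    (hA : ContinuousOn A (Ico 0 b)) (hd : ContinuousOn d (Ico 0 b))
    (hd' : ∀ x ∈ Ioo 0 b, HasDerivAt d (d' x) x) (hle : ∀ x ∈ Ioo 0 b, A x * d x ≤ d' x)
    (h0 : 0 ≤ d 0) : ∀ x ∈ Ico 0 b, 0 ≤ d x := by
  intro x hx
  have hsub : Icc 0 x ⊆ Ico 0 b := fun y hy => ⟨hy.1, hy.2.trans_lt hx.2⟩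
  have hAi : IntervalIntegrable A MeasureTheory.volume 0 x :=
    ContinuousOn.intervalIntegrable (by rw [uIcc_of_le hx.1]; exact hA.mono hsub)
  let B : ℝ → ℝ := fun y => ∫ t in (0 : ℝ)..y, A t
  have hBc : ContinuousOn B (Icc 0 x) := by
    have := intervalIntegral.continuousOn_primitive_interval (a := 0) (b := x) (f := A)
      (μ := MeasureTheory.volume) (by
        rw [uIcc_of_le hx.1]
        exact (hA.mono hsub).integrableOn_Icc)
    rwa [uIcc_of_le hx.1] at this
  have hBd : ∀ y ∈ Ioo 0 x, HasDerivAt B (A y) y := by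
    intro y hy
    have hyb : y ∈ Ioo 0 b := ⟨hy.1, hy.2.trans hx.2⟩
    have hAo : ContinuousOn A (Ioo 0 b) := hA.mono Ioo_subset_Ico_self
    refine intervalIntegral.integral_hasDerivAt_right
      (hAi.mono_set ?_) (hAo.stronglyMeasurableAtFilter isOpen_Ioo y hyb)
      (hAo.continuousAt (isOpen_Ioo.mem_nhds hyb))
    rw [uIcc_of_le hx.1, uIcc_of_le hy.1.le]
    exact Icc_subset_Icc_right hy.2.le
  have hmono : MonotoneOn (fun y => d y * Real.exp (-B y)) (Icc 0 x) := by
    refine monotoneOn_of_hasDerivWithinAt_nonneg (convex_Icc 0 x)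
      (f' := fun y => d' y * Real.exp (-B y) + d y * (Real.exp (-B y) * -A y)) ?_ ?_ ?_
    · exact (hd.mono hsub).mul (Real.continuous_exp.comp_continuousOn hBc.neg)
    · intro y hy
      rw [interior_Icc] at hy
      exact ((hd' y ⟨hy.1, hy.2.trans hx.2⟩).mul ((hBd y hy).neg.exp)).hasDerivWithinAt
    · intro y hy
      rw [interior_Icc] at hy
      have := hle y ⟨hy.1, hy.2.trans hx.2⟩
      have he := Real.exp_pos (-B y)
      nlinarith
  have := hmono (left_mem_Icc.2 hx.1) (right_mem_Icc.2 hx.1) hx.1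
  have hB0 : B 0 = 0 := intervalIntegral.integral_same
  simp only [hB0, neg_zero, Real.exp_zero, mul_one] at this
  exact nonneg_of_mul_nonneg_left (h0.trans this) (Real.exp_pos _)

lemma cos_pos_of_mem_Ico {x : ℝ} (hx : x ∈ Ico 0 (Real.pi / 2)) : 0 < Real.cos x :=
  Real.cos_pos_of_mem_Ioo ⟨by linarith [hx.1, Real.pi_pos], hx.2⟩

lemma continuousOn_tan_Ico : ContinuousOn Real.tan (Ico 0 (Real.pi / 2)) := fun _ hx =>
  (Real.continuousAt_tan.2 (cos_pos_of_mem_Ico hx).ne').continuousWithinAt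

/-- Comparison principle for the Riccati equation: a subsolution lies below a supersolution. -/
lemma riccati_comparison {N j : ℕ} {f g f' g' : ℝ → ℝ}
    (hf : ContinuousOn f (Ico 0 (Real.pi / 2))) (hg : ContinuousOn g (Ico 0 (Real.pi / 2)))
    (hf' : ∀ x ∈ Ioo 0 (Real.pi / 2), HasDerivAt f (f' x) x)
    (hg' : ∀ x ∈ Ioo 0 (Real.pi / 2), HasDerivAt g (g' x) x)
    (hfs : ∀ x ∈ Ioo 0 (Real.pi / 2),
      f' x ≤ -(f x) ^ 2 + ((N : ℝ) - 1) * Real.tan x * f x + gam N j / Real.cos x ^ 2)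
    (hgs : ∀ x ∈ Ioo 0 (Real.pi / 2),
      -(g x) ^ 2 + ((N : ℝ) - 1) * Real.tan x * g x + gam N j / Real.cos x ^ 2 ≤ g' x)
    (h0 : f 0 ≤ g 0) : ∀ x ∈ Ico 0 (Real.pi / 2), f x ≤ g x := by
  intro x hx
  -- The difference of the quadratic terms factors, `g² - f² = (f + g)(g - f)`, so `g - f` satisfies
  -- a linear inequality whose coefficient `A` is continuous up to `0`.
  refine sub_nonneg.1 (nonneg_of_linear_differential_inequality
    (A := fun x => -(f x + g x) + ((N : ℝ) - 1) * Real.tan x) (d := fun x => g x - f x)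
    (d' := fun x => g' x - f' x) ?_ (hg.sub hf) (fun y hy => (hg' y hy).sub (hf' y hy)) ?_
    (sub_nonneg.2 h0) x hx)
  · exact (hf.add hg).neg.add (continuousOn_const.mul continuousOn_tan_Ico)
  · intro y hy
    have h1 := hfs y hy
    have h2 := hgs y hy
    ring_nf at h1 h2 ⊢
    linarith

lemma IsRiccatiSolution.eqOn {N j : ℕ} {f g : ℝ → ℝ} (hf : IsRiccatiSolution N j f)
    (hg : IsRiccatiSolution N j g) : EqOn f g (Ico 0 (Real.pi / 2)) := fun x hx =>
  le_antisymm
    (riccati_comparison hf.cont hg.cont hf.ode hg.ode (fun _ _ => le_rfl) (fun _ _ => le_rfl)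
      (by rw [hf.init, hg.init]) x hx)
    (riccati_comparison hg.cont hf.cont hg.ode hf.ode (fun _ _ => le_rfl) (fun _ _ => le_rfl)
      (by rw [hf.init, hg.init]) x hx)

lemma isRiccatiSolution_zero (N : ℕ) : IsRiccatiSolution N 0 fun _ => 0 where
  cont := continuousOn_const
  ode := fun x _ => by simpa [gam] using hasDerivAt_const x (0 : ℝ)
  init := rfl

lemma isRiccatiSolution_one (N : ℕ) :
    IsRiccatiSolution N 1 fun x => ((N : ℝ) - 1) * Real.tan x where
  cont := continuousOn_const.mul continuousOn_tan_Ico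
  ode := fun x hx => by
    have hc := cos_pos_of_mem_Ico (Ioo_subset_Ico_self hx)
    refine ((Real.hasDerivAt_tan hc.ne').const_mul ((N : ℝ) - 1)).congr_deriv ?_
    simp only [gam]
    push_cast
    ring
  init := by simp

/-- The radicand is the perfect square `(N - 2 + 2j)²`. -/
lemma cCoef_eq {N : ℕ} (hN : 2 ≤ N) (j : ℕ) : cCoef N j = (N : ℝ) - 2 + j := by
  have : (2 : ℝ) ≤ N := by exact_mod_cast hN
  have hj : (0 : ℝ) ≤ j := j.cast_nonneg
  rw [cCoef, gam, show ((N : ℝ) - 2) ^ 2 + 4 * ((j : ℝ) * ((N : ℝ) - 2 + j)) =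
    ((N : ℝ) - 2 + 2 * j) ^ 2 by ring, Real.sqrt_sq (by linarith)]
  ring

lemma cCoef_mul_tan_le {N : ℕ} (hN : 2 ≤ N) {j : ℕ} (hj : 1 ≤ j) {f : ℝ → ℝ}
    (hf : IsRiccatiSolution N j f) :
    ∀ x ∈ Ico 0 (Real.pi / 2), cCoef N j * Real.tan x ≤ f x := by
  have hN' : (2 : ℝ) ≤ N := by exact_mod_cast hN
  have hj' : (1 : ℝ) ≤ j := by exact_mod_cast hj
  refine riccati_comparison (N := N) (j := j)
    (continuousOn_const.mul continuousOn_tan_Ico) hf.cont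
    (fun _ hx => (Real.hasDerivAt_tan
      (cos_pos_of_mem_Ico (Ioo_subset_Ico_self hx)).ne').const_mul _)
    hf.ode ?_ (fun _ _ => le_rfl) (by simp [hf.init])
  intro x hx
  have hc := cos_pos_of_mem_Ico (Ioo_subset_Ico_self hx)
  have hS : Real.sin x ^ 2 = 1 - Real.cos x ^ 2 := by linarith [Real.sin_sq_add_cos_sq x]
  rw [cCoef_eq hN, gam, Real.tan_eq_sin_div_cos]
  set c : ℝ := (N : ℝ) - 2 + j with hcdef
  -- Because `N - 1 - c = 1 - j` and `γ_j = j c`, the singular terms cancel and the defect of the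
  -- subsolution is the constant `c (j - 1)`.
  rw [← sub_nonneg, show -(c * (Real.sin x / Real.cos x)) ^ 2 + ((N : ℝ) - 1) *
      (Real.sin x / Real.cos x) * (c * (Real.sin x / Real.cos x)) + j * c / Real.cos x ^ 2 -
      c * (1 / Real.cos x ^ 2) = c * (j - 1) by
    field_simp
    rw [hS, hcdef]
    ring]
  exact mul_nonneg (by linarith) (by linarith)

lemma le_sqrt_gam_div_cos {N : ℕ} (hN : 2 ≤ N) {j : ℕ} (hj : 1 ≤ j) {f : ℝ → ℝ}
    (hf : IsRiccatiSolution N j f) :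
    ∀ x ∈ Ico 0 (Real.pi / 2), f x ≤ (N : ℝ) * Real.sqrt (gam N j) / Real.cos x := by
  have hN' : (2 : ℝ) ≤ N := by exact_mod_cast hN
  have hj' : (1 : ℝ) ≤ j := by exact_mod_cast hj
  have hg : 1 ≤ gam N j := by
    rw [gam]
    nlinarith
  set s := Real.sqrt (gam N j) with hs
  have hs1 : 1 ≤ s := Real.one_le_sqrt.2 hg
  have hs2 : gam N j = s ^ 2 := (Real.sq_sqrt (by linarith)).symm
  refine riccati_comparison (N := N) (j := j) (g' := fun x =>
      N * s * (Real.sin x / Real.cos x ^ 2)) hf.cont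
    (fun x hx => (continuousAt_const.div Real.continuous_cos.continuousAt
      (cos_pos_of_mem_Ico hx).ne').continuousWithinAt)
    hf.ode (fun x hx => ?_) (fun _ _ => le_rfl) ?_ ?_
  · have hc := cos_pos_of_mem_Ico (Ioo_subset_Ico_self hx)
    refine ((hasDerivAt_const x ((N : ℝ) * s)).div (Real.hasDerivAt_cos x) hc.ne').congr_deriv ?_
    field_simp
    ring
  · intro x hx
    have hc := cos_pos_of_mem_Ico (Ioo_subset_Ico_self hx)
    have hsin1 := Real.sin_le_one x
    have hsin0 : 0 ≤ Real.sin x :=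
      Real.sin_nonneg_of_nonneg_of_le_pi hx.1.le (by linarith [hx.2, Real.pi_pos])
    rw [hs2, Real.tan_eq_sin_div_cos, ← sub_nonneg]
    -- The defect of the supersolution is nonnegative since `s ≥ 1`, `sin x ≤ 1` and `N² - 1 ≥ N(N -
    -- 2)`.
    rw [show N * s * (Real.sin x / Real.cos x ^ 2) - (-(N * s / Real.cos x) ^ 2 + ((N : ℝ) - 1) *
        (Real.sin x / Real.cos x) * (N * s / Real.cos x) + s ^ 2 / Real.cos x ^ 2) =
        s * ((N ^ 2 - 1) * s - N * (N - 2) * Real.sin x) / Real.cos x ^ 2 by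
      field_simp
      ring]
    have h1 : (N : ℝ) * (N - 2) * Real.sin x ≤ N * (N - 2) * 1 := by
      gcongr
    have h2 : ((N : ℝ) ^ 2 - 1) * 1 ≤ (N ^ 2 - 1) * s := by
      gcongr
      nlinarith
    refine div_nonneg (mul_nonneg (by linarith) (by nlinarith)) (by positivity)
  · rw [hf.init]
    simp only [Real.cos_zero, div_one]
    positivity

/-! ### The homogeneous extension and its Laplacian -/

lemma radialExt_coe {N : ℕ} (f : Sph N → ℝ) (σ : Sph N) : radialExt f (σ : EuclideanSpace ℝ (Fin N)) = f σ := by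
  have h1 : ‖(σ : EuclideanSpace ℝ (Fin N))‖ = 1 := by simp
  have h0 : (σ : EuclideanSpace ℝ (Fin N)) ≠ 0 := by
    intro h
    simp [h] at h1
  rw [radialExt, dif_neg h0]
  congr 1
  ext1
  simp [h1]

lemma coe_ne_zero {N : ℕ} (σ : Sph N) : (σ : EuclideanSpace ℝ (Fin N)) ≠ 0 := by
  have h1 : ‖(σ : EuclideanSpace ℝ (Fin N))‖ = 1 := by simp
  exact norm_ne_zero_iff.1 (by rw [h1]; norm_num)

lemma radialExt_const_mul {N : ℕ} (c : ℝ) (f : Sph N → ℝ) :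
    radialExt (fun σ => c * f σ) = c • radialExt f := by
  ext x
  simp only [radialExt, Pi.smul_apply, smul_eq_mul]
  split_ifs <;> simp

lemma radialExt_sub {N : ℕ} (f g : Sph N → ℝ) :
    radialExt (fun σ => f σ - g σ) = radialExt f - radialExt g := by
  ext x
  simp only [radialExt, Pi.sub_apply]
  split_ifs <;> simp

lemma hasDerivAt_line {N : ℕ} (x v : EuclideanSpace ℝ (Fin N)) (s : ℝ) :
    HasDerivAt (fun s : ℝ => x + s • v) v s := by
  simpa using ((hasDerivAt_id s).smul_const v).const_add x

lemma hasDerivAt_comp_line {N : ℕ} {f : EuclideanSpace ℝ (Fin N) → ℝ}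
    {x : EuclideanSpace ℝ (Fin N)} (hf : ContDiffAt ℝ 2 f x) (v : EuclideanSpace ℝ (Fin N)) :
    ∀ᶠ s in 𝓝 (0 : ℝ), HasDerivAt (fun s : ℝ => f (x + s • v)) (fderiv ℝ f (x + s • v) v) s := by
  have h1 : ∀ᶠ y in 𝓝 x, ContDiffAt ℝ 2 f y := hf.eventually (by simp)
  have h2 : Tendsto (fun s : ℝ => x + s • v) (𝓝 0) (𝓝 x) := by
    have := (hasDerivAt_line x v 0).continuousAt.tendsto
    simpa using this
  filter_upwards [h2.eventually h1] with s hs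
  exact (hs.differentiableAt (by norm_num)).hasFDerivAt.comp_hasDerivAt s (hasDerivAt_line x v s)

/-- Reduces the Laplacian to one-variable second derivatives, used both for computing it on
harmonics and for its sign at a maximum. -/
lemma iteratedFDeriv_two_eq_deriv_deriv {N : ℕ} {f : EuclideanSpace ℝ (Fin N) → ℝ}
    {x : EuclideanSpace ℝ (Fin N)} (hf : ContDiffAt ℝ 2 f x) (v : EuclideanSpace ℝ (Fin N)) :
    iteratedFDeriv ℝ 2 f x ![v, v] = deriv (deriv fun s : ℝ => f (x + s • v)) 0 := by
  have h1 : deriv (fun s : ℝ => f (x + s • v)) =ᶠ[𝓝 0] fun s => fderiv ℝ f (x + s • v) v :=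
    (hasDerivAt_comp_line hf v).mono fun s hs => hs.deriv
  rw [h1.deriv_eq, iteratedFDeriv_two_apply]
  have h2 : HasFDerivAt (fderiv ℝ f) (fderiv ℝ (fderiv ℝ f) x) (x + (0 : ℝ) • v) := by
    rw [zero_smul, add_zero]
    exact ((hf.fderiv_right (m := 1) one_add_one_eq_two.le).differentiableAt
      one_ne_zero).hasFDerivAt
  have h3 : HasDerivAt (fun s : ℝ => fderiv ℝ f (x + s • v)) (fderiv ℝ (fderiv ℝ f) x v) 0 :=
    h2.comp_hasDerivAt (0 : ℝ) (hasDerivAt_line x v 0)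
  exact (((ContinuousLinearMap.apply ℝ ℝ v).hasFDerivAt.comp_hasDerivAt (0 : ℝ) h3).deriv).symm

lemma laplacian_eq_sum_deriv_deriv {N : ℕ} {f : EuclideanSpace ℝ (Fin N) → ℝ}
    {x : EuclideanSpace ℝ (Fin N)} (hf : ContDiffAt ℝ 2 f x) :
    Laplacian.laplacian f x =
      ∑ i, deriv (deriv fun s : ℝ => f (x + s • EuclideanSpace.single i (1 : ℝ))) 0 := by
  rw [InnerProductSpace.laplacian_eq_iteratedFDeriv_orthonormalBasis f
    (EuclideanSpace.basisFun (Fin N) ℝ)]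
  exact Finset.sum_congr rfl fun i _ => by
    rw [EuclideanSpace.basisFun_apply, iteratedFDeriv_two_eq_deriv_deriv hf]

/-- If the second derivative were positive, the point would also be a local minimum, so `g` would be
locally constant and its second derivative zero. -/
lemma deriv_deriv_nonpos_of_isLocalMax {g : ℝ → ℝ} {x : ℝ} (h : IsLocalMax g x)
    (hc : ContinuousAt g x) : deriv (deriv g) x ≤ 0 := by
  by_contra! hpos
  have hmin := isLocalMin_of_deriv_deriv_pos hpos h.deriv_eq_zero hc
  have heq : g =ᶠ[𝓝 x] fun _ => g x := by
    filter_upwards [h, hmin] with y h1 h2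
    exact le_antisymm h1 h2
  have : deriv (deriv g) x = 0 := by
    rw [heq.deriv.deriv_eq]
    simp
  linarith

lemma laplacian_nonpos_of_isLocalMax {N : ℕ} {f : EuclideanSpace ℝ (Fin N) → ℝ}
    {x : EuclideanSpace ℝ (Fin N)} (hf : ContDiffAt ℝ 2 f x) (h : IsLocalMax f x) :
    Laplacian.laplacian f x ≤ 0 := by
  rw [laplacian_eq_sum_deriv_deriv hf]
  refine Finset.sum_nonpos fun i _ => ?_
  have hl := (hasDerivAt_line x (EuclideanSpace.single i (1 : ℝ)) 0).continuousAt
  have hx : x + (0 : ℝ) • EuclideanSpace.single i (1 : ℝ) = x := by simp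
  refine deriv_deriv_nonpos_of_isLocalMax ?_ ?_
  · have h2 := hl.tendsto
    rw [hx] at h2
    filter_upwards [h2.eventually h] with s hs
    simpa using hs
  · exact ContinuousAt.comp (by rw [hx]; exact hf.continuousAt) hl

/-! ### Spherical harmonics -/

lemma hasDerivAt_eval_line {N : ℕ} (P : MvPolynomial (Fin N) ℝ) (x : Fin N → ℝ) (i : Fin N) (s : ℝ) :
    HasDerivAt (fun s : ℝ => MvPolynomial.eval (x + s • Pi.single i (1 : ℝ)) P)
      (MvPolynomial.eval (x + s • Pi.single i (1 : ℝ)) (MvPolynomial.pderiv i P)) s := by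
  induction P using MvPolynomial.induction_on with
  | C a => simpa using hasDerivAt_const s a
  | add p q hp hq => simp only [map_add]; exact hp.add hq
  | mul_X p k hp =>
    have hX : HasDerivAt (fun s : ℝ => MvPolynomial.eval (x + s • Pi.single i (1 : ℝ))
        (MvPolynomial.X k : MvPolynomial (Fin N) ℝ)) ((Pi.single i (1 : ℝ) : Fin N → ℝ) k) s := by
      simpa using ((hasDerivAt_id s).mul_const ((Pi.single i (1 : ℝ) : Fin N → ℝ) k)).const_add (x k)
    have := hp.mul hX
    simp only [MvPolynomial.pderiv_mul, MvPolynomial.pderiv_X, map_mul, map_add]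
    convert! this using 1
    rcases eq_or_ne i k with rfl | hik <;> simp [*]

lemma eval_smul_of_isHomogeneous {N j : ℕ} {P : MvPolynomial (Fin N) ℝ} (hP : P.IsHomogeneous j)
    (c : ℝ) (x : Fin N → ℝ) : MvPolynomial.eval (c • x) P = c ^ j * MvPolynomial.eval x P := by
  rw [MvPolynomial.eval_eq, MvPolynomial.eval_eq, Finset.mul_sum]
  refine Finset.sum_congr rfl fun d hd => ?_
  have hdeg : ∑ i, d i = j := by
    have := hP (MvPolynomial.mem_support_iff.1 hd)
    rw [← this, Finsupp.weight_apply, Finsupp.sum_fintype _ _ (by simp)]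
    simp
  have hprod : ∏ i ∈ d.support, (c • x) i ^ d i = c ^ j * ∏ i ∈ d.support, x i ^ d i := by
    simp only [Pi.smul_apply, smul_eq_mul, mul_pow, Finset.prod_mul_distrib]
    rw [Finset.prod_pow_eq_pow_sum, ← hdeg, Finset.sum_subset (Finset.subset_univ d.support)]
    intro i _ hi
    simpa using hi
  rw [hprod]
  ring

/-- The factor is written as a real power of `|x|²` because `|x|²` is smooth, and a quadratic
polynomial along lines. -/
lemma radialExt_eq_of_isHomogeneous {N j : ℕ} {P : MvPolynomial (Fin N) ℝ}
    (hP : P.IsHomogeneous j) {Y : Sph N → ℝ}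
    (hY : ∀ σ : Sph N, Y σ = MvPolynomial.eval (fun i => (σ : EuclideanSpace ℝ (Fin N)) i) P)
    {x : EuclideanSpace ℝ (Fin N)} (hx : x ≠ 0) :
    radialExt Y x = (‖x‖ ^ 2) ^ (-(j / 2) : ℝ) * MvPolynomial.eval (fun i => x i) P := by
  rw [radialExt, dif_neg hx, hY]
  have h := eval_smul_of_isHomogeneous hP ‖x‖⁻¹ fun i => x i
  have hn : 0 ≤ ‖x‖ := norm_nonneg x
  have h2 : (‖x‖ ^ 2) ^ (-(j / 2) : ℝ) = ‖x‖⁻¹ ^ j := by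
    rw [← Real.rpow_natCast ‖x‖ 2, ← Real.rpow_mul hn,
      show ((2 : ℕ) : ℝ) * (-(j / 2) : ℝ) = -(j : ℝ) by push_cast; ring, Real.rpow_neg hn,
      Real.rpow_natCast, inv_pow]
  rw [h2, ← h]
  rfl

lemma contDiff_eval {N : ℕ} (P : MvPolynomial (Fin N) ℝ) (n : ℕ) :
    ContDiff ℝ n fun x : EuclideanSpace ℝ (Fin N) => MvPolynomial.eval (fun i => x i) P := by
  induction P using MvPolynomial.induction_on with
  | C a => simpa using contDiff_const
  | add p q hp hq => simp only [map_add]; exact hp.add hq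
  | mul_X p k hp =>
    simp only [map_mul, MvPolynomial.eval_X]
    exact hp.mul (by fun_prop)

lemma contDiffAt_radialExt_of_isHomogeneous {N j : ℕ} {P : MvPolynomial (Fin N) ℝ}
    (hP : P.IsHomogeneous j) {Y : Sph N → ℝ}
    (hY : ∀ σ : Sph N, Y σ = MvPolynomial.eval (fun i => (σ : EuclideanSpace ℝ (Fin N)) i) P)
    {x : EuclideanSpace ℝ (Fin N)} (hx : x ≠ 0) (n : ℕ) : ContDiffAt ℝ n (radialExt Y) x := by
  have hev : radialExt Y =ᶠ[𝓝 x] fun x =>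
      (‖x‖ ^ 2) ^ (-(j / 2) : ℝ) * MvPolynomial.eval (fun i => x i) P := by
    filter_upwards [isOpen_ne.mem_nhds hx] with y hy
    exact radialExt_eq_of_isHomogeneous hP hY hy
  refine ContDiffAt.congr_of_eventuallyEq ?_ hev
  refine ContDiffAt.mul ?_ ?_
  · exact (contDiff_norm_sq ℝ).contDiffAt.rpow_const_of_ne
      (pow_ne_zero _ (norm_ne_zero_iff.2 hx))
  · exact (contDiff_eval P n).contDiffAt

lemma norm_sq_add_smul_single {N : ℕ} (σ : Sph N) (i : Fin N) (s : ℝ) :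
    ‖(σ : EuclideanSpace ℝ (Fin N)) + s • EuclideanSpace.single i (1 : ℝ)‖ ^ 2 =
      1 + 2 * (s * (σ : EuclideanSpace ℝ (Fin N)) i) + s ^ 2 := by
  have h1 : ‖(σ : EuclideanSpace ℝ (Fin N))‖ = 1 := by simp
  rw [norm_add_sq_real, h1, norm_smul, inner_smul_right, EuclideanSpace.inner_single_right]
  simp

/-- Second derivative of a spherical harmonic, extended homogeneously of degree `0`, along a
coordinate line. -/
lemma deriv_deriv_radialExt_line {N j : ℕ} {P : MvPolynomial (Fin N) ℝ}
    (hP : P.IsHomogeneous j) {Y : Sph N → ℝ}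
    (hY : ∀ σ : Sph N, Y σ = MvPolynomial.eval (fun i => (σ : EuclideanSpace ℝ (Fin N)) i) P)
    (σ : Sph N) (i : Fin N) :
    deriv (deriv fun s : ℝ => radialExt Y
        ((σ : EuclideanSpace ℝ (Fin N)) + s • EuclideanSpace.single i (1 : ℝ))) 0 =
      (j * (j + 2) * (σ : EuclideanSpace ℝ (Fin N)) i ^ 2 - j) *
          MvPolynomial.eval (fun k => (σ : EuclideanSpace ℝ (Fin N)) k) P -
        2 * j * MvPolynomial.eval (fun k => (σ : EuclideanSpace ℝ (Fin N)) k)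
          (MvPolynomial.X i * MvPolynomial.pderiv i P) +
        MvPolynomial.eval (fun k => (σ : EuclideanSpace ℝ (Fin N)) k)
          (MvPolynomial.pderiv i (MvPolynomial.pderiv i P)) := by
  set a : ℝ := -(j / 2) with ha
  set y : Fin N → ℝ := fun k => (σ : EuclideanSpace ℝ (Fin N)) k with hy
  -- `q s` is `|σ + s e_i|²`, so near `s = 0` the extension restricted to the line is `q^a · P` with
  -- `q ≠ 0`.
  let q : ℝ → ℝ := fun s => 1 + 2 * (s * y i) + s ^ 2
  let l : ℝ → Fin N → ℝ := fun s => y + s • Pi.single i (1 : ℝ)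
  have hq : ∀ s, HasDerivAt q (2 * y i + 2 * s) s := fun s => by
    have := ((((hasDerivAt_id s).mul_const (y i)).const_mul 2).const_add 1).add (hasDerivAt_pow 2 s)
    refine this.congr_deriv ?_
    simp
  have hq0 : q 0 = 1 := by simp [q]
  have hl0 : l 0 = y := by simp [l]
  have hqne : ∀ᶠ s in 𝓝 (0 : ℝ), q s ≠ 0 :=
    (hq 0).continuousAt.eventually_ne (by rw [hq0]; norm_num)
  have hp := hasDerivAt_eval_line P y i
  have hp' := hasDerivAt_eval_line (MvPolynomial.pderiv i P) y i
  have hev : (fun s : ℝ => radialExt Y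
      ((σ : EuclideanSpace ℝ (Fin N)) + s • EuclideanSpace.single i (1 : ℝ))) =ᶠ[𝓝 0]
      fun s => q s ^ a * MvPolynomial.eval (l s) P := by
    filter_upwards [hqne] with s hs
    have hn := norm_sq_add_smul_single σ i s
    have hx : (σ : EuclideanSpace ℝ (Fin N)) + s • EuclideanSpace.single i (1 : ℝ) ≠ 0 := by
      intro h0
      apply hs
      rw [h0] at hn
      simpa [q] using hn.symm
    rw [radialExt_eq_of_isHomogeneous hP hY hx, hn]
    congr 2
  have hd1 : deriv (fun s => q s ^ a * MvPolynomial.eval (l s) P) =ᶠ[𝓝 0] fun s =>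
      (2 * y i + 2 * s) * a * q s ^ (a - 1) * MvPolynomial.eval (l s) P +
        q s ^ a * MvPolynomial.eval (l s) (MvPolynomial.pderiv i P) := by
    filter_upwards [hqne] with s hs
    exact (((hq s).rpow_const (p := a) (Or.inl hs)).mul (hp s)).deriv
  rw [hev.deriv.deriv_eq, hd1.deriv_eq]
  have hlin : HasDerivAt (fun s : ℝ => (2 * y i + 2 * s) * a) (2 * a) 0 := by
    simpa using (((hasDerivAt_id (0 : ℝ)).const_mul 2).const_add (2 * y i)).mul_const a
  have h10 : q 0 ≠ 0 := by rw [hq0]; norm_num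
  have hd2 := ((hlin.mul ((hq 0).rpow_const (p := a - 1) (Or.inl h10))).mul (hp 0)).add
    (((hq 0).rpow_const (p := a) (Or.inl h10)).mul (hp' 0))
  rw [show y + (0 : ℝ) • Pi.single i (1 : ℝ) = y by simp] at hd2
  refine hd2.deriv.trans ?_
  simp only [hq0, Real.one_rpow, map_mul, MvPolynomial.eval_X, mul_zero, add_zero, mul_one,
    Pi.mul_apply]
  rw [ha]
  ring

lemma sphLaplacian_of_isSphericalHarmonic {N j : ℕ} {Y : Sph N → ℝ}
    (hY : IsSphericalHarmonic j Y) (σ : Sph N) : sphLaplacian Y σ = -gam N j * Y σ := by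
  obtain ⟨P, hP, hharm, hY⟩ := hY
  have h1 : ‖(σ : EuclideanSpace ℝ (Fin N))‖ = 1 := by simp
  rw [sphLaplacian, laplacian_eq_sum_deriv_deriv
    (contDiffAt_radialExt_of_isHomogeneous hP hY (coe_ne_zero σ) 2)]
  simp only [deriv_deriv_radialExt_line hP hY]
  -- Harmonicity kills the pure second derivatives and Euler's identity turns `∑ x_i ∂_i P` into `j
  -- P`. With `|σ| = 1` the total factor is `j(j+2) - Nj - 2j² = -γ_j`.
  rw [Finset.sum_add_distrib, Finset.sum_sub_distrib, ← Finset.sum_mul, ← Finset.mul_sum,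
    ← map_sum, ← map_sum, hharm, hP.sum_X_mul_pderiv, Finset.sum_sub_distrib, ← Finset.mul_sum]
  have hsum : ∑ i, (σ : EuclideanSpace ℝ (Fin N)) i ^ 2 = 1 := by
    rw [← EuclideanSpace.real_norm_sq_eq, h1, one_pow]
  rw [hsum, ← hY]
  simp [gam, ← hY]
  ring

/-! ### Regularity of separated functions. -/

lemma contDiffOn_separated {N j : ℕ} {Y : Sph N → ℝ} (hY : IsSphericalHarmonic j Y)
    {H : ℝ → ℝ} {I : Set ℝ} {n : ℕ} (hH : ContDiffOn ℝ n H I) :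
    ContDiffOn ℝ n (fun p : EuclideanSpace ℝ (Fin N) × ℝ =>
      radialExt (fun σ => H p.2 * Y σ) p.1) ({0}ᶜ ×ˢ I) := by
  obtain ⟨P, hP, -, hY⟩ := hY
  simp only [radialExt_const_mul, Pi.smul_apply, smul_eq_mul]
  refine (hH.comp contDiffOn_snd fun p hp => hp.2).mul ?_
  have : ContDiffOn ℝ n (radialExt Y) {0}ᶜ := fun x hx =>
    (contDiffAt_radialExt_of_isHomogeneous hP hY hx n).contDiffWithinAt
  exact this.comp contDiffOn_fst fun p hp => hp.1

/-- As `b > 1`, the function is `C³` on an open set containing `D`. Its second derivative is then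
locally Lipschitz, hence Lipschitz on the compact cylinder, hence `α`-Hölder there by boundedness.
-/
lemma isC2Holder_separated {N j : ℕ} {Y : Sph N → ℝ} (hY : IsSphericalHarmonic j Y)
    {H : ℝ → ℝ} {b : ℝ} (hb : 1 < b) (hH : ContDiffOn ℝ (3 : ℕ) H (Ioo (-b) b)) {α : ℝ≥0}
    (hα : α ≤ 1) : IsC2Holder α fun (σ : Sph N) t => H t * Y σ := by
  unfold IsC2Holder
  extract_lets Ψ D
  have hU : IsOpen (({0}ᶜ : Set (EuclideanSpace ℝ (Fin N))) ×ˢ Ioo (-b) b) :=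
    isOpen_compl_singleton.prod isOpen_Ioo
  have hDU : D ⊆ {0}ᶜ ×ˢ Ioo (-b) b := prod_mono_right fun t ht =>
    ⟨by linarith [ht.1], by linarith [ht.2]⟩
  have hΨ : ContDiffOn ℝ (3 : ℕ) Ψ ({0}ᶜ ×ˢ Ioo (-b) b) := contDiffOn_separated hY hH
  have hΨD : ContDiffOn ℝ (3 : ℕ) Ψ D := hΨ.mono hDU
  have hD : UniqueDiffOn ℝ D :=
    isOpen_compl_singleton.uniqueDiffOn.prod (uniqueDiffOn_Icc (by norm_num))
  refine ⟨hΨD.of_le (by norm_cast), ?_⟩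
  set K : Set (EuclideanSpace ℝ (Fin N) × ℝ) :=
    Metric.sphere (0 : EuclideanSpace ℝ (Fin N)) 1 ×ˢ Icc (-1) 1 with hK
  have hKc : IsCompact K := (isCompact_sphere _ _).prod isCompact_Icc
  have hKD : K ⊆ D := prod_mono_left fun x hx => coe_ne_zero ⟨x, hx⟩
  have hloc : LocallyLipschitzOn K (iteratedFDerivWithin ℝ 2 Ψ D) := by
    intro x hx
    have hxD := hKD hx
    have hat : ∀ y ∈ D, ContDiffAt ℝ (3 : ℕ) Ψ y := fun y hy =>
      hΨ.contDiffAt (hU.mem_nhds (hDU hy))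
    have h1 : ContDiffAt ℝ 1 (iteratedFDeriv ℝ 2 Ψ) x :=
      (hat x hxD).iteratedFDeriv_right (by norm_cast)
    obtain ⟨C, t, ht, hL⟩ := h1.exists_lipschitzOnWith
    refine ⟨C, t ∩ K, inter_mem (mem_nhdsWithin_of_mem_nhds ht) self_mem_nhdsWithin, ?_⟩
    intro y hy z hz
    have heq : ∀ y ∈ K, iteratedFDerivWithin ℝ 2 Ψ D y = iteratedFDeriv ℝ 2 Ψ y := fun y hy =>
      iteratedFDerivWithin_eq_iteratedFDeriv hD ((hat y (hKD hy)).of_le (by norm_cast)) (hKD hy)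
    rw [heq y hy.2, heq z hz.2]
    exact hL hy.1 hz.1
  obtain ⟨C, hC⟩ := hloc.exists_lipschitzOnWith_of_compact hKc
  obtain ⟨B, hB⟩ := Metric.isBounded_iff.1 hKc.isBounded
  refine ⟨_, (holderOnWith_one.2 hC).of_le (D := B.toNNReal) (fun x hx y hy => ?_) hα⟩
  rw [edist_dist]
  exact ENNReal.ofReal_le_ofReal (hB hx hy)

/-! ### The maximum principle -/

lemma hasDerivAt_deriv_of_contDiffAt_two {f : ℝ → ℝ} {t : ℝ} (hf : ContDiffAt ℝ 2 f t) :
    HasDerivAt (deriv f) (deriv (deriv f) t) t := by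
  have h : DifferentiableAt ℝ (fderiv ℝ f) t :=
    (hf.fderiv_right (m := 1) one_add_one_eq_two.le).differentiableAt one_ne_zero
  exact (h.clm_apply (differentiableAt_const (1 : ℝ))).hasDerivAt

lemma deriv_mul_deriv {c f : ℝ → ℝ} {c' t : ℝ} (hc : HasDerivAt c c' t) (hf : ContDiffAt ℝ 2 f t) :
    deriv (fun s => c s * deriv f s) t = c' * deriv f t + c t * deriv (deriv f) t :=
  (hc.mul (hasDerivAt_deriv_of_contDiffAt_two hf)).deriv

lemma hasDerivAt_cos_mul_pow (lam t : ℝ) (n : ℕ) :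
    HasDerivAt (fun s => Real.cos (lam * s) ^ n)
      ((n : ℝ) * Real.cos (lam * t) ^ (n - 1) * (-Real.sin (lam * t) * lam)) t := by
  refine (((hasDerivAt_id t).const_mul lam).cos.pow n).congr_deriv ?_
  simp

lemma IsC2Holder.contDiffAt {N : ℕ} {α : ℝ≥0} {ψ : Sph N → ℝ → ℝ} (h : IsC2Holder α ψ)
    (σ : Sph N) {t : ℝ} (ht : t ∈ Ioo (-1 : ℝ) 1) :
    ContDiffAt ℝ 2 (fun p : EuclideanSpace ℝ (Fin N) × ℝ => radialExt (fun σ => ψ σ p.2) p.1)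
      ((σ : EuclideanSpace ℝ (Fin N)), t) :=
  h.1.contDiffAt (prod_mem_nhds (isOpen_compl_singleton.mem_nhds (coe_ne_zero σ))
    (Icc_mem_nhds ht.1 ht.2))

lemma IsC2Holder.contDiffAt_slice {N : ℕ} {α : ℝ≥0} {ψ : Sph N → ℝ → ℝ} (h : IsC2Holder α ψ)
    (σ : Sph N) {t : ℝ} (ht : t ∈ Ioo (-1 : ℝ) 1) :
    ContDiffAt ℝ 2 (radialExt fun σ' => ψ σ' t) (σ : EuclideanSpace ℝ (Fin N)) :=
  (h.contDiffAt σ ht).comp (f := fun x : EuclideanSpace ℝ (Fin N) => (x, t))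
    (σ : EuclideanSpace ℝ (Fin N)) (contDiffAt_id.prodMk contDiffAt_const)

lemma IsC2Holder.contDiffAt_fiber {N : ℕ} {α : ℝ≥0} {ψ : Sph N → ℝ → ℝ} (h : IsC2Holder α ψ)
    (σ : Sph N) {t : ℝ} (ht : t ∈ Ioo (-1 : ℝ) 1) : ContDiffAt ℝ 2 (ψ σ) t := by
  have := (h.contDiffAt σ ht).comp (f := fun t : ℝ => ((σ : EuclideanSpace ℝ (Fin N)), t)) t
    (contDiffAt_const.prodMk contDiffAt_id)
  simpa [Function.comp_def, radialExt_coe] using this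

lemma cos_mul_pos {lam t : ℝ} (hlam : lam ∈ Ioo 0 (Real.pi / 2)) (ht : t ∈ Icc (-1 : ℝ) 1) :
    0 < Real.cos (lam * t) :=
  Real.cos_pos_of_mem_Ioo ⟨by nlinarith [hlam.1, hlam.2, ht.1], by nlinarith [hlam.1, hlam.2, ht.2]⟩

/-- The exponential barrier in the `t` direction is a strict subsolution. -/
lemma exists_barrier_exponent (N : ℕ) {lam : ℝ} (hlam : lam ∈ Ioo 0 (Real.pi / 2)) :
    ∃ k : ℝ, 0 < k ∧ ∀ t ∈ Icc (-1 : ℝ) 1,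
      0 < ((N - 1 : ℕ) : ℝ) * Real.cos (lam * t) ^ (N - 1 - 1) * (-Real.sin (lam * t) * lam) +
        k * Real.cos (lam * t) ^ (N - 1) := by
  have hc0 : 0 < Real.cos lam := by simpa using cos_mul_pos hlam (t := 1) (by simp)
  have hl := hlam.1
  set m : ℝ := ((N - 1 : ℕ) : ℝ) with hm
  have hm0 : 0 ≤ m := Nat.cast_nonneg _
  have hq : 0 < Real.cos lam ^ (N - 1) := pow_pos hc0 _
  -- The derivative of `cos^{N-1}(λt)` is at least `-mλ`, and `cos(λt) ≥ cos λ` on `[-1, 1]`: the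
  -- first summand compensates `-mλ`, the `1` gives strictness.
  refine ⟨m * lam / Real.cos lam ^ (N - 1) + 1, by positivity, fun t ht => ?_⟩
  have hct := cos_mul_pos hlam ht
  have hge : Real.cos lam ≤ Real.cos (lam * t) := by
    rw [← Real.cos_abs (lam * t), abs_mul, abs_of_pos hl]
    refine Real.cos_le_cos_of_nonneg_of_le_pi (by positivity) (by linarith [hlam.2, Real.pi_pos]) ?_
    have := abs_le.2 ht
    nlinarith
  have hp : Real.cos lam ^ (N - 1) ≤ Real.cos (lam * t) ^ (N - 1) := by gcongr
  have h1 : Real.cos (lam * t) ^ (N - 1 - 1) * Real.sin (lam * t) ≤ 1 := by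
    have ha : Real.cos (lam * t) ^ (N - 1 - 1) ≤ 1 := pow_le_one₀ hct.le (Real.cos_le_one _)
    have hb := pow_nonneg hct.le (N - 1 - 1)
    nlinarith [Real.sin_le_one (lam * t)]
  have h2 : m * lam ≤ m * lam / Real.cos lam ^ (N - 1) * Real.cos (lam * t) ^ (N - 1) := by
    rw [div_mul_eq_mul_div, le_div_iff₀ hq]
    gcongr
  have h3 : 0 < Real.cos (lam * t) ^ (N - 1) := pow_pos hct _
  have h4 := mul_le_mul_of_nonneg_left h1 (mul_nonneg hm0 hl.le)
  linarith

/-- Weak maximum principle: adding `ε e^{kt}` to `ψ₁ - ψ₂` makes it a strict subsolution, which has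
no interior maximum. Its boundary values are at most `ε e^k`, and `ε → 0` concludes. -/
lemma IsDirichletSolution.le {N : ℕ} {α : ℝ≥0} {lam : ℝ} (hlam : lam ∈ Ioo 0 (Real.pi / 2))
    {ω : Sph N → ℝ} {ψ₁ ψ₂ : Sph N → ℝ → ℝ} (h₁ : IsDirichletSolution α lam ω ψ₁)
    (h₂ : IsDirichletSolution α lam ω ψ₂) (σ : Sph N) {t : ℝ} (ht : t ∈ Icc (-1 : ℝ) 1) :
    ψ₁ σ t ≤ ψ₂ σ t := by
  obtain ⟨k, hk, hbar⟩ := exists_barrier_exponent N hlam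
  suffices hmain : ∀ ε > 0, ψ₁ σ t - ψ₂ σ t + ε * Real.exp (k * t) ≤ ε * Real.exp k by
    refine le_of_forall_pos_le_add fun δ hδ => ?_
    have := hmain (δ / Real.exp k) (by positivity)
    rw [div_mul_cancel₀ _ (Real.exp_pos k).ne'] at this
    have h0 : 0 ≤ δ / Real.exp k * Real.exp (k * t) := by positivity
    linarith
  intro ε hε
  set K : Set (EuclideanSpace ℝ (Fin N) × ℝ) :=
    Metric.sphere (0 : EuclideanSpace ℝ (Fin N)) 1 ×ˢ Icc (-1) 1 with hK
  let G : EuclideanSpace ℝ (Fin N) × ℝ → ℝ := fun p =>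
    radialExt (fun σ => ψ₁ σ p.2) p.1 - radialExt (fun σ => ψ₂ σ p.2) p.1 + ε * Real.exp (k * p.2)
  have hG : ∀ (τ : Sph N) s, G ((τ : EuclideanSpace ℝ (Fin N)), s) =
      ψ₁ τ s - ψ₂ τ s + ε * Real.exp (k * s) := fun τ s => by simp only [G, radialExt_coe]
  have hKD : K ⊆ {0}ᶜ ×ˢ Icc (-1) 1 := prod_mono_left fun x hx => coe_ne_zero ⟨x, hx⟩
  have hcont : ContinuousOn G K :=
    ((h₁.regular.1.continuousOn.mono hKD).sub (h₂.regular.1.continuousOn.mono hKD)).add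
      (by fun_prop)
  obtain ⟨⟨x₀, t₀⟩, hp, hmax⟩ := ((isCompact_sphere _ _).prod isCompact_Icc).exists_isMaxOn
    (s := K) ⟨((σ : EuclideanSpace ℝ (Fin N)), t), σ.2, ht⟩ hcont
  lift x₀ to Sph N using hp.1 with τ
  have ht₀ : t₀ ∈ Icc (-1 : ℝ) 1 := hp.2
  have hm : ∀ (ρ : Sph N), ∀ s ∈ Icc (-1 : ℝ) 1, ψ₁ ρ s - ψ₂ ρ s + ε * Real.exp (k * s) ≤
      ψ₁ τ t₀ - ψ₂ τ t₀ + ε * Real.exp (k * t₀) := fun ρ s hs => by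
    rw [← hG, ← hG]
    exact hmax (show ((ρ : EuclideanSpace ℝ (Fin N)), s) ∈ K from ⟨ρ.2, hs⟩)
  refine (hm σ t ht).trans ?_
  rcases eq_endpoints_or_mem_Ioo_of_mem_Icc ht₀ with rfl | rfl | hint
  · rw [(h₁.boundary τ).2, (h₂.boundary τ).2, sub_self, zero_add]
    gcongr
    linarith
  · rw [(h₁.boundary τ).1, (h₂.boundary τ).1, sub_self, zero_add, mul_one]
  exfalso
  -- A maximum over the sphere becomes a local maximum in `ℝ^N` of the degree-`0` extension, so the
  -- Euclidean second derivative test applies.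
  have hsph : sphLaplacian (fun σ' => ψ₁ σ' t₀) τ - sphLaplacian (fun σ' => ψ₂ σ' t₀) τ ≤ 0 := by
    have c₁ := h₁.regular.contDiffAt_slice τ hint
    have c₂ := h₂.regular.contDiffAt_slice τ hint
    rw [sphLaplacian, sphLaplacian, ← c₁.laplacian_sub c₂]
    refine laplacian_nonpos_of_isLocalMax (c₁.sub c₂) ?_
    rw [← radialExt_sub]
    filter_upwards [isOpen_ne.mem_nhds (coe_ne_zero τ)] with y hy
    rw [radialExt_coe, radialExt, dif_neg hy]
    exact le_of_add_le_add_right (hm _ t₀ ht₀)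
  have f₁ := h₁.regular.contDiffAt_fiber τ hint
  have f₂ := h₂.regular.contDiffAt_fiber τ hint
  have fe : ContDiffAt ℝ 2 (fun s => ε * Real.exp (k * s)) t₀ := by fun_prop
  have de : deriv (fun s => ε * Real.exp (k * s)) = fun s => ε * k * Real.exp (k * s) := by
    ext s
    have := ((((hasDerivAt_id s).const_mul k).exp).const_mul ε).deriv
    simp only [id] at this
    rw [this]
    ring
  have dde : deriv (fun s => ε * k * Real.exp (k * s)) t₀ = ε * k * k * Real.exp (k * t₀) := by
    have := ((((hasDerivAt_id t₀).const_mul k).exp).const_mul (ε * k)).deriv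
    simp only [id] at this
    rw [this]
    ring
  let g : ℝ → ℝ := fun s => ψ₁ τ s - ψ₂ τ s + ε * Real.exp (k * s)
  have hgmax : IsLocalMax g t₀ := by
    filter_upwards [Icc_mem_nhds hint.1 hint.2] with s hs
    exact hm τ s hs
  have hg : ContDiffAt ℝ 2 g t₀ := (f₁.sub f₂).add fe
  have hdg : ∀ s, ContDiffAt ℝ 2 (ψ₁ τ) s → ContDiffAt ℝ 2 (ψ₂ τ) s →
      deriv g s = deriv (ψ₁ τ) s - deriv (ψ₂ τ) s + ε * k * Real.exp (k * s) := by
    intro s k₁ k₂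
    have d₁ := (k₁.differentiableAt two_ne_zero).hasDerivAt
    have d₂ := (k₂.differentiableAt two_ne_zero).hasDerivAt
    have d₃ : HasDerivAt (fun s => ε * Real.exp (k * s)) (ε * k * Real.exp (k * s)) s := by
      have h := (show DifferentiableAt ℝ (fun s => ε * Real.exp (k * s)) s by fun_prop).hasDerivAt
      rwa [de] at h
    exact ((d₁.sub d₂).add d₃).deriv
  have hg1 : deriv (ψ₁ τ) t₀ - deriv (ψ₂ τ) t₀ + ε * k * Real.exp (k * t₀) = 0 := by
    rw [← hdg t₀ f₁ f₂, hgmax.deriv_eq_zero]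
  have hg2 : deriv (deriv (ψ₁ τ)) t₀ - deriv (deriv (ψ₂ τ)) t₀ +
      ε * k * k * Real.exp (k * t₀) ≤ 0 := by
    have hev : deriv g =ᶠ[𝓝 t₀] fun s =>
        deriv (ψ₁ τ) s - deriv (ψ₂ τ) s + ε * k * Real.exp (k * s) := by
      filter_upwards [f₁.eventually (by simp), f₂.eventually (by simp)] with s k₁ k₂
      exact hdg s k₁ k₂
    have hd := ((hasDerivAt_deriv_of_contDiffAt_two f₁).sub
      (hasDerivAt_deriv_of_contDiffAt_two f₂)).add
      (show DifferentiableAt ℝ (fun s => ε * k * Real.exp (k * s)) t₀ by fun_prop).hasDerivAt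
    have hle := deriv_deriv_nonpos_of_isLocalMax hgmax hg.continuousAt
    rw [hev.deriv_eq] at hle
    rw [← dde]
    exact hd.deriv.symm.trans_le hle
  have e₁ := h₁.harmonic τ t₀ hint
  have e₂ := h₂.harmonic τ t₀ hint
  have hb := hbar t₀ ht₀
  have hcpos := cos_mul_pos hlam ht₀
  have hc := hasDerivAt_cos_mul_pow lam t₀ (N - 1)
  rw [cylLaplacian, deriv_mul_deriv hc f₁] at e₁
  rw [cylLaplacian, deriv_mul_deriv hc f₂] at e₂
  have hcN := pow_pos hcpos (N - 1)
  have hl := hlam.1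
  generalize ((N - 1 : ℕ) : ℝ) * Real.cos (lam * t₀) ^ (N - 1 - 1) *
    (-Real.sin (lam * t₀) * lam) = c' at *
  generalize Real.cos (lam * t₀) ^ (N - 1) = c at *
  have hA : 0 < (lam ^ 2 * c)⁻¹ := by positivity
  have hB : 0 ≤ (Real.cos (lam * t₀) ^ 2)⁻¹ := by positivity
  have hpos : 0 < ε * k * Real.exp (k * t₀) := by positivity
  -- At the maximum `c' g' + c g'' ≤ 0`, while the barrier's share `ε k e^{kt₀} (c' + k c)` is
  -- positive; so the share of `ψ₁ - ψ₂` is negative, which contradicts the two equations.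
  have hneg : (c' * deriv (ψ₁ τ) t₀ + c * deriv (deriv (ψ₁ τ)) t₀) -
      (c' * deriv (ψ₂ τ) t₀ + c * deriv (deriv (ψ₂ τ)) t₀) < 0 := by
    have a1 := mul_pos hpos hb
    have a2 := mul_nonpos_of_nonneg_of_nonpos hcN.le hg2
    have a3 : c' * (deriv (ψ₁ τ) t₀ - deriv (ψ₂ τ) t₀ + ε * k * Real.exp (k * t₀)) = 0 := by
      rw [hg1, mul_zero]
    linarith
  have b1 := mul_neg_of_pos_of_neg hA hneg
  have b2 := mul_nonpos_of_nonneg_of_nonpos hB hsph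
  linarith

lemma IsDirichletSolution.eqOn {N : ℕ} {α : ℝ≥0} {lam : ℝ} (hlam : lam ∈ Ioo 0 (Real.pi / 2))
    {ω : Sph N → ℝ} {ψ₁ ψ₂ : Sph N → ℝ → ℝ} (h₁ : IsDirichletSolution α lam ω ψ₁)
    (h₂ : IsDirichletSolution α lam ω ψ₂) (σ : Sph N) : EqOn (ψ₁ σ) (ψ₂ σ) (Icc (-1) 1) :=
  fun _ ht => le_antisymm (h₁.le hlam h₂ σ ht) (h₂.le hlam h₁ σ ht)

/-! ### Separated solutions -/

lemma mul_mem_Ioo_half_pi {lam t : ℝ} (hlam : lam ∈ Ioo 0 (Real.pi / 2))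
    (ht : t ∈ Ioo (-(Real.pi / 2 / lam)) (Real.pi / 2 / lam)) :
    lam * t ∈ Ioo (-(Real.pi / 2)) (Real.pi / 2) := by
  have h1 := (lt_div_iff₀ hlam.1).1 ht.2
  have h2 := (div_lt_iff₀ hlam.1).1 (show -(Real.pi / 2) / lam < t by rw [neg_div]; exact ht.1)
  constructor <;> linarith

lemma hasDerivAt_radialSol_mul {N : ℕ} (hN : 1 ≤ N) (j : ℕ) {lam t : ℝ}
    (ht : lam * t ∈ Ioo (-(Real.pi / 2)) (Real.pi / 2)) :
    HasDerivAt (fun s => radialSol N j (lam * s) / radialSol N j lam)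
      (lam * riccatiSol N j (lam * t) * (radialSol N j (lam * t) / radialSol N j lam)) t := by
  have h := ((hasDerivAt_radialSol hN j ht).comp t ((hasDerivAt_id t).const_mul lam)).div_const
    (radialSol N j lam)
  refine h.congr_deriv ?_
  ring

/-- The solution of the Dirichlet problem whose boundary value is a spherical harmonic. -/
lemma isDirichletSolution_separated {N : ℕ} (hN : 2 ≤ N) {α : ℝ≥0} (hα : α ≤ 1) {lam : ℝ}
    (hlam : lam ∈ Ioo 0 (Real.pi / 2)) {j : ℕ} {Y : Sph N → ℝ} (hY : IsSphericalHarmonic j Y) :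
    IsDirichletSolution α lam Y
      fun σ t => radialSol N j (lam * t) / radialSol N j lam * Y σ := by
  have hN1 : 1 ≤ N := by omega
  have hb : 1 < Real.pi / 2 / lam := (one_lt_div hlam.1).2 hlam.2
  have hpos : 0 < radialSol N j lam :=
    radialSol_pos hN1 j ⟨by linarith [hlam.1, Real.pi_pos], hlam.2⟩
  have hH : ContDiffOn ℝ (3 : ℕ) (fun t => radialSol N j (lam * t) / radialSol N j lam)
      (Ioo (-(Real.pi / 2 / lam)) (Real.pi / 2 / lam)) := by
    refine ContDiffOn.div_const ?_ _
    exact (contDiffOn_radialSol hN1 j 3).comp (contDiff_const.mul contDiff_id).contDiffOn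
      fun t ht => mul_mem_Ioo_half_pi hlam ht
  refine ⟨isC2Holder_separated hY hb hH hα, fun σ t ht => ?_, fun σ => ?_⟩
  · have ht' : lam * t ∈ Ioo (-(Real.pi / 2)) (Real.pi / 2) :=
      mul_mem_Ioo_half_pi hlam ⟨by linarith [ht.1], by linarith [ht.2]⟩
    have hc := Real.cos_pos_of_mem_Ioo ht'
    have hl := hlam.1
    have hsph : sphLaplacian (fun σ' => radialSol N j (lam * t) / radialSol N j lam * Y σ') σ =
        radialSol N j (lam * t) / radialSol N j lam * (-gam N j * Y σ) := by
      obtain ⟨P, hP, -, hYP⟩ := id hY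
      rw [sphLaplacian, radialExt_const_mul, InnerProductSpace.laplacian_smul _
        (contDiffAt_radialExt_of_isHomogeneous hP hYP (coe_ne_zero σ) 2), smul_eq_mul,
        ← sphLaplacian_of_isSphericalHarmonic hY σ, sphLaplacian]
    have hev : (fun s => Real.cos (lam * s) ^ (N - 1) *
        deriv (fun t => radialSol N j (lam * t) / radialSol N j lam * Y σ) s) =ᶠ[𝓝 t] fun s =>
        Real.cos (lam * s) ^ (N - 1) * (lam * riccatiSol N j (lam * s) *
          (radialSol N j (lam * s) / radialSol N j lam) * Y σ) := by
      filter_upwards [Ioo_mem_nhds ht.1 ht.2] with s hs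
      rw [((hasDerivAt_radialSol_mul hN1 j (mul_mem_Ioo_half_pi hlam
        ⟨by linarith [hs.1], by linarith [hs.2]⟩)).mul_const (Y σ)).deriv]
    have hf : HasDerivAt (fun s => riccatiSol N j (lam * s)) _ t :=
      (hasDerivAt_riccatiSol hN1 j ht').comp t ((hasDerivAt_id t).const_mul lam)
    have hd := ((hasDerivAt_cos_mul_pow lam t (N - 1)).mul
      (((hf.const_mul lam).mul (hasDerivAt_radialSol_mul hN1 j ht')).mul_const (Y σ))).deriv
    rw [cylLaplacian, hev.deriv_eq, hsph]
    refine (congrArg₂ (· + ·) (congrArg _ hd) rfl).trans ?_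
    -- With `N = 2 + m` the truncated exponents become `m + 1` and `m`; the Riccati equation then
    -- cancels the radial part against `γ_j / cos²`.
    obtain ⟨m, rfl⟩ := Nat.exists_eq_add_of_le hN
    simp only [show 2 + m - 1 = m + 1 by omega, Nat.add_sub_cancel, Real.tan_eq_sin_div_cos,
      Pi.mul_apply]
    push_cast
    generalize radialSol (2 + m) j (lam * t) / radialSol (2 + m) j lam = H
    field_simp
    ring
  · have h1 : radialSol N j (lam * (-1)) = radialSol N j lam := by
      rw [mul_neg_one, radialSol_neg]
    simp only [h1, mul_one, div_self hpos.ne', one_mul, and_self]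

/-! ### The eigenvalue equation for the linearized operator. -/

lemma derivWithin_separated {N : ℕ} (hN : 1 ≤ N) {lam : ℝ} (hlam : lam ∈ Ioo 0 (Real.pi / 2))
    (j : ℕ) (y : ℝ) :
    derivWithin (fun t => radialSol N j (lam * t) / radialSol N j lam * y) (Icc (-1) 1) 1 =
      lam * riccatiSol N j lam * y := by
  have hmem : lam ∈ Ioo (-(Real.pi / 2)) (Real.pi / 2) := ⟨by linarith [hlam.1, Real.pi_pos], hlam.2⟩
  have h := (hasDerivAt_radialSol_mul hN j (lam := lam) (t := 1) (by rwa [mul_one])).mul_const y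
  rw [h.hasDerivWithinAt.derivWithin (uniqueDiffOn_Icc (by norm_num) 1 (by simp)), mul_one,
    div_self (radialSol_pos hN j hmem).ne', mul_one]

lemma IsProfile.deriv_deriv {N : ℕ} (hN : 2 ≤ N) {u : ℝ → ℝ} (hu : IsProfile N u) {θ : ℝ}
    (hθ : θ ∈ Ioo (-(Real.pi / 2)) (Real.pi / 2)) :
    deriv (deriv u) θ = ((N : ℝ) - 1) * Real.tan θ * deriv u θ - 1 := by
  have hc := Real.cos_pos_of_mem_Ioo hθ
  have h := hu.ode θ hθ
  have hcos := (Real.hasDerivAt_cos θ).pow (N - 1)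
  have hd : deriv (fun s => Real.cos s ^ (N - 1) * deriv u s) θ = _ :=
    deriv_mul_deriv hcos (hu.regular.contDiffAt (Ioo_mem_nhds hθ.1 hθ.2))
  rw [hd] at h
  obtain ⟨m, rfl⟩ := Nat.exists_eq_add_of_le hN
  simp only [show 2 + m - 1 = m + 1 by omega, Nat.add_sub_cancel] at h
  rw [Real.tan_eq_sin_div_cos]
  push_cast at h ⊢
  field_simp at h ⊢
  refine mul_left_cancel₀ (pow_ne_zero m hc.ne') ?_
  linear_combination h

lemma linOp_of_isSphericalHarmonic {N : ℕ} (hN : 2 ≤ N) {α : ℝ≥0} (hα : α ≤ 1) {u : ℝ → ℝ}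
    (hu : IsProfile N u) {lam : ℝ} (hlam : lam ∈ Ioo 0 (Real.pi / 2)) {j : ℕ} {Y : Sph N → ℝ}
    (hY : IsSphericalHarmonic j Y) :
    linOp α u lam Y = sigmaEig N u (riccatiSol N j) lam • Y := by
  have hsol := isDirichletSolution_separated hN hα hlam hY
  have hex : ∃ ψ, IsDirichletSolution α lam Y ψ := ⟨_, hsol⟩
  ext σ
  -- The solution picked by choice agrees with the separated one on `[-1, 1]`, which suffices for
  -- the one-sided derivative at `1`.
  rw [linOp, dif_pos hex, derivWithin_congr (hex.choose_spec.eqOn hlam hsol σ)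
    (hex.choose_spec.eqOn hlam hsol σ (by simp)), derivWithin_separated (by omega) hlam,
    hu.deriv_deriv hN ⟨by linarith [hlam.1, Real.pi_pos], hlam.2⟩, Pi.smul_apply, smul_eq_mul,
    sigmaEig]
  have := hlam.1.ne'
  field_simp
  ring

end SerrinSphere

end

theorem proposition3p1 (N : ℕ) (hN : 2 ≤ N) :
    ∃ f : ℕ → ℝ → ℝ,
      -- `f j` is the unique solution on `[0, π/2)` of the Riccati initial value problem
      (∀ j, IsRiccatiSolution N j (f j) ∧
        ∀ g, IsRiccatiSolution N j g → EqOn g (f j) (Ico 0 (Real.pi / 2))) ∧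
      -- spherical harmonics: unique solvability of the Dirichlet problem, eigenvalue equation
      (∀ (α : ℝ≥0), 0 < α → α < 1 → ∀ u : ℝ → ℝ, IsProfile N u →
        ∀ lam ∈ Ioo 0 (Real.pi / 2), ∀ (j : ℕ) (Y : Sph N → ℝ), IsSphericalHarmonic j Y →
          (∃ ψ, IsDirichletSolution α lam Y ψ ∧
            ∀ ψ', IsDirichletSolution α lam Y ψ' → ∀ σ, EqOn (ψ' σ) (ψ σ) (Icc (-1) 1)) ∧
          linOp α u lam Y = sigmaEig N u (f j) lam • Y) ∧
      (∀ lam ∈ Ico 0 (Real.pi / 2), f 0 lam = 0) ∧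
      (∀ lam ∈ Ico 0 (Real.pi / 2), f 1 lam = ((N : ℝ) - 1) * Real.tan lam) ∧
      (∀ j, 2 ≤ j → (N : ℝ) - 1 < cCoef N j ∧
        ∀ lam ∈ Ico 0 (Real.pi / 2),
          cCoef N j * Real.tan lam ≤ f j lam ∧
          f j lam ≤ (N : ℝ) * Real.sqrt (gam N j) / Real.cos lam) := by
  have hf : ∀ j, IsRiccatiSolution N j (riccatiSol N j) :=
    isRiccatiSolution_riccatiSol (by omega)
  refine ⟨riccatiSol N, fun j => ⟨hf j, fun g hg => hg.eqOn (hf j)⟩, ?_,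
    (hf 0).eqOn (isRiccatiSolution_zero N), (hf 1).eqOn (isRiccatiSolution_one N), ?_⟩
  · intro α _ hα u hu lam hlam j Y hY
    exact ⟨⟨_, isDirichletSolution_separated hN hα.le hlam hY, fun ψ' h' =>
      h'.eqOn hlam (isDirichletSolution_separated hN hα.le hlam hY)⟩,
      linOp_of_isSphericalHarmonic hN hα.le hu hlam hY⟩
  · intro j hj
    refine ⟨?_, fun lam hlam => ⟨cCoef_mul_tan_le hN (by omega) (hf j) lam hlam,
      le_sqrt_gam_div_cos hN (by omega) (hf j) lam hlam⟩⟩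
    have : (2 : ℝ) ≤ j := by exact_mod_cast hj
    rw [cCoef_eq hN]
    linarith
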